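/- For a continuous function $h:\mathbb R\to[0,\infty)$ let $\Omega_h=\{(x,y)\in\mathbb R^2:\ 0<y<h(x)\}$. For $V>0$ let $\mathcal A_V$ be the set of pairs $(u,h)$ such that $h\in H^1(\mathbb R)$ (represented by its continuous representative), $h\ge 0$, $\int_{\mathbb R}h\,dx=V$, $u\in H^1(\Omega_h)$, and $u(x,0)=x$ on $\{h>0\}$ in the sense of traces. Set $$F_s(V)=\inf\Big\{\int_{\Omega_h}|\nabla u|^2\,dx\,dy+\int_{\mathbb R}(h')^2\,dx\ :\ (u,h)\in\mathcal A_V\Big\},$$ where $\nabla u$ and $h'$ are weak derivatives. Proposition. There exists $\overline V>0$ such that $F_s(V)=V$ for every $0<V\le\overline V$, and such that for every $0<V<\overline V$ the infimum defining $F_s(V)$ is not attained, i.e. no pair $(u,h)\in\mathcal A_V$ is a minimizer. -/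

import Mathlib

open MeasureTheory Set
open scoped ContDiff

noncomputable section

namespace ThinFilm

/-- `g` is the weak derivative of `f` in the direction `v` on the (open) set `Ω`. -/
def HasWeakDerivOn {E : Type*} [NormedAddCommGroup E] [NormedSpace ℝ E] [MeasureSpace E]
    (Ω : Set E) (v : E) (f g : E → ℝ) : Prop :=
  LocallyIntegrableOn f Ω volume ∧ LocallyIntegrableOn g Ω volume ∧
    ∀ φ : E → ℝ, ContDiff ℝ ∞ φ → HasCompactSupport φ → tsupport φ ⊆ Ω →
      ∫ x in Ω, f x * fderiv ℝ φ x v = -∫ x in Ω, g x * φ x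

/-- Weak derivatives on an open set are unique up to null sets. -/
theorem HasWeakDerivOn.ae_unique {E : Type*} [NormedAddCommGroup E] [NormedSpace ℝ E]
    [FiniteDimensional ℝ E] [MeasureSpace E] [BorelSpace E] {Ω : Set E} (hΩ : IsOpen Ω)
    {v : E} {f g₁ g₂ : E → ℝ} (h₁ : HasWeakDerivOn Ω v f g₁) (h₂ : HasWeakDerivOn Ω v f g₂) :
    g₁ =ᵐ[volume.restrict Ω] g₂ := by
  have hint : ∀ g : E → ℝ, LocallyIntegrableOn g Ω volume → ∀ φ : E → ℝ, ContDiff ℝ ∞ φ →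
      HasCompactSupport φ → tsupport φ ⊆ Ω → Integrable (fun x => g x * φ x) volume := by
    intro g hg φ hφ hc hs
    have h := (hg.integrableOn_compact_subset hs hc).mul_continuousOn hφ.continuous.continuousOn hc
    refine (integrableOn_iff_integrable_of_support_subset ?_).1 h
    intro x hx
    exact subset_tsupport φ fun h0 => hx (by simp [h0])
  have key := hΩ.ae_eq_zero_of_integral_contDiff_smul_eq_zero (h₁.2.1.sub h₂.2.1) (by
    intro φ hφ hc hs
    have i₁ := hint g₁ h₁.2.1 φ hφ hc hs
    have i₂ := hint g₂ h₂.2.1 φ hφ hc hs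
    have hset : ∀ g : E → ℝ, ∫ x in Ω, g x * φ x = ∫ x, g x * φ x := fun g =>
      setIntegral_eq_integral_of_forall_compl_eq_zero fun x hx => by
        have : φ x = 0 := image_eq_zero_of_notMem_tsupport fun h => hx (hs h)
        simp [this]
    have e : ∫ x, g₁ x * φ x = ∫ x, g₂ x * φ x := by
      rw [← hset, ← hset]
      exact neg_injective ((h₁.2.2 φ hφ hc hs).symm.trans (h₂.2.2 φ hφ hc hs))
    calc ∫ x, φ x • (g₁ - g₂) x = ∫ x, (g₁ x * φ x - g₂ x * φ x) := by
          congr 1; ext x; simp only [Pi.sub_apply, smul_eq_mul]; ring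
      _ = 0 := by rw [integral_sub i₁ i₂, e, sub_self])
  filter_upwards [(ae_restrict_iff' hΩ.measurableSet).2 key] with x hx
  simpa [sub_eq_zero] using hx

open Classical in
/-- The weak derivative of `f` in the direction `v` on the open set `Ω` (well defined up to null
sets), and `0` if there is none. -/
def weakDerivOn {E : Type*} [NormedAddCommGroup E] [NormedSpace ℝ E] [MeasureSpace E]
    (Ω : Set E) (v : E) (f : E → ℝ) : E → ℝ :=
  if h : ∃ g, HasWeakDerivOn Ω v f g then h.choose else 0

/-- `f ∈ H¹(Ω)`: `f` and all its first order weak derivatives are in `L²(Ω)`. -/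
def MemH1 {E : Type*} [NormedAddCommGroup E] [NormedSpace ℝ E] [MeasureSpace E]
    (Ω : Set E) (f : E → ℝ) : Prop :=
  MemLp f 2 (volume.restrict Ω) ∧
    ∀ v : E, ∃ g, HasWeakDerivOn Ω v f g ∧ MemLp g 2 (volume.restrict Ω)

/-- The region `Ω_h = {(x, y) : 0 < y < h x}` occupied by the film. -/
def film (h : ℝ → ℝ) : Set (ℝ × ℝ) := {p | 0 < p.2 ∧ p.2 < h p.1}

/-- `u(x, 0) = g x` on `{h > 0}`, in the sense of traces, for `u ∈ H¹(Ω_h)`. This is Green's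
formula for test functions that vanish near the graph of `h` but not necessarily on the bottom
`{h > 0} × {0}` of `Ω_h`. -/
def HasBottomTrace (h : ℝ → ℝ) (u : ℝ × ℝ → ℝ) (g : ℝ → ℝ) : Prop :=
  ∀ φ : ℝ × ℝ → ℝ, ContDiff ℝ ∞ φ → HasCompactSupport φ → tsupport φ ⊆ {p | p.2 < h p.1} →
    ∫ p in film h, (u p * fderiv ℝ φ p (0, 1) + weakDerivOn (film h) (0, 1) u p * φ p) =
      -∫ x : ℝ, g x * φ (x, 0)

/-- The set of admissible pairs `(u, h)` of volume `V`. The profile `h ∈ H¹(ℝ)` is given by its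
continuous representative. -/
def admissible (V : ℝ) : Set ((ℝ × ℝ → ℝ) × (ℝ → ℝ)) :=
  {q | Continuous q.2 ∧ MemH1 univ q.2 ∧ (∀ x, 0 ≤ q.2 x) ∧ MemH1 (film q.2) q.1 ∧
    Integrable q.2 volume ∧ ∫ x, q.2 x = V ∧ HasBottomTrace q.2 q.1 fun x => x}

/-- The elastic energy `∫_{Ω_h} |∇u|²`. -/
def elasticEnergy (u : ℝ × ℝ → ℝ) (h : ℝ → ℝ) : ℝ :=
  ∫ p in film h,
    (weakDerivOn (film h) (1, 0) u p ^ 2 + weakDerivOn (film h) (0, 1) u p ^ 2)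

/-- The small-slope surface energy `∫ h'²`. -/
def surfaceEnergy (h : ℝ → ℝ) : ℝ := ∫ x, weakDerivOn univ 1 h x ^ 2

/-- The total energy of a pair `(u, h)`. -/
def energy (q : (ℝ × ℝ → ℝ) × (ℝ → ℝ)) : ℝ := elasticEnergy q.1 q.2 + surfaceEnergy q.2

/-- The minimal energy `F_s(V)`. -/
def minEnergy (V : ℝ) : ℝ := sInf (energy '' admissible V)

/-- `(u, h)` is a minimizer of the small-slope problem of volume `V`. -/
def IsMinimizer (V : ℝ) (q : (ℝ × ℝ → ℝ) × (ℝ → ℝ)) : Prop :=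
  q ∈ admissible V ∧ IsMinOn energy (admissible V) q

end ThinFilm

end

namespace ThinFilm

open Filter Topology Convolution ContinuousLinearMap

/-! The infimum is approached by spreading the film out: with `u = x` the elastic energy is the area
V, while a profile stretched to width of order 1/t has surface energy of order t³
(`exists_admissible_energy_le`). Everything else is the strict bound energy > V for V ≤ 1/4
(`lt_energy`), which gives both the value of the infimum and its non-attainment.

For the bound, put I = ∫(u_x - 1), B = ∫u_y², D = ∫h'². Expanding the square, energy - V = ∫(u_x -
1)² + 2I + B + D, so only a negative I can hurt. The field (1, h') is divergence free and tangent to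
the graph of h, and u - x vanishes on the bottom; Green's formula therefore gives formally I = -∫
u_y h'. By Cauchy-Schwarz and Fubini, I² ≤ B ∫ h h'² ≤ M B D whenever h ≤ M
(`sq_integral_sub_one_le`). If M < 1 and D > 0, then 2|I| < B + D. An energy at most V ≤ 1/4 forces
D ≤ 1/4, and Hölder continuity of h then gives M = 3/4 (`le_three_quarters`).

As h is only H¹ and the trace is defined by test functions, the field (1, h') is replaced by smooth,
compactly supported fields with the same cancellation (`exists_test_field`), built from
mollifications of h. -/

/-! ### Quadratic integral inequalities -/

theorem integral_sub_add {α : Type*} [MeasurableSpace α] {μ : Measure α} {f g k : α → ℝ}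
    (hf : Integrable f μ) (hg : Integrable g μ) (hk : Integrable k μ) :
    ∫ x, (f x - g x + k x) ∂μ = ∫ x, f x ∂μ - ∫ x, g x ∂μ + ∫ x, k x ∂μ := by
  rw [← integral_sub hf hg]
  exact integral_add (hf.sub hg) hk

/-- The Cauchy-Schwarz inequality for integrals of real functions. -/
theorem sq_integral_mul_le {α : Type*} [MeasurableSpace α] {μ : Measure α} {f g : α → ℝ}
    (hf : MemLp f 2 μ) (hg : MemLp g 2 μ) :
    (∫ x, f x * g x ∂μ) ^ 2 ≤ (∫ x, f x ^ 2 ∂μ) * ∫ x, g x ^ 2 ∂μ := by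
  have hfg : Integrable (fun x => f x * g x) μ := hf.integrable_mul hg
  -- The polynomial t ↦ ∫ (f - t g)² is nonnegative, so its discriminant is at most 0.
  have key : ∀ t : ℝ, 0 ≤ (∫ x, g x ^ 2 ∂μ) * (t * t) + (-2 * ∫ x, f x * g x ∂μ) * t +
      ∫ x, f x ^ 2 ∂μ := by
    intro t
    have e : ∫ x, (f x - t * g x) ^ 2 ∂μ = (∫ x, g x ^ 2 ∂μ) * (t * t) +
        (-2 * ∫ x, f x * g x ∂μ) * t + ∫ x, f x ^ 2 ∂μ := by
      calc ∫ x, (f x - t * g x) ^ 2 ∂μ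
          = ∫ x, (f x ^ 2 - 2 * t * (f x * g x) + t ^ 2 * g x ^ 2) ∂μ := by
            congr 1; ext x; ring
        _ = _ := by
            rw [integral_sub_add hf.integrable_sq (hfg.const_mul _) (hg.integrable_sq.const_mul _),
              integral_const_mul, integral_const_mul]
            ring
    rw [← e]
    exact integral_nonneg fun x => sq_nonneg _
  have := discrim_le_zero key
  rw [discrim] at this
  linarith

/-- Jensen's inequality for the square and a probability density. -/
theorem sq_integral_density_le {α : Type*} [MeasurableSpace α] {μ : Measure α} {w g : α → ℝ}
    (hw : ∀ x, 0 ≤ w x) (iw : Integrable w μ) (hw1 : ∫ x, w x ∂μ = 1)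
    (h1 : Integrable (fun x => w x * g x) μ) (h2 : Integrable (fun x => w x * g x ^ 2) μ) :
    (∫ x, w x * g x ∂μ) ^ 2 ≤ ∫ x, w x * g x ^ 2 ∂μ := by
  set m := ∫ x, w x * g x ∂μ with hm
  have h : 0 ≤ ∫ x, w x * (g x - m) ^ 2 ∂μ :=
    integral_nonneg fun x => mul_nonneg (hw x) (sq_nonneg _)
  have e : ∫ x, w x * (g x - m) ^ 2 ∂μ
      = ∫ x, (w x * g x ^ 2 - 2 * m * (w x * g x) + m ^ 2 * w x) ∂μ := by
    congr 1; ext x; ring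
  rw [e, integral_sub_add h2 (h1.const_mul _) (iw.const_mul _), integral_const_mul, integral_const_mul, hw1, ← hm] at h
  nlinarith

/-! ### Mollification and Hölder continuity on the line -/

/-- The mollification of a function on the line by a bump function. -/
noncomputable def mollify (ρ : ContDiffBump (0 : ℝ)) (h : ℝ → ℝ) : ℝ → ℝ :=
  ρ.normed volume ⋆[lsmul ℝ ℝ, volume] h

theorem mollify_apply (ρ : ContDiffBump (0 : ℝ)) (h : ℝ → ℝ) (x : ℝ) :
    mollify ρ h x = ∫ t, ρ.normed volume (x - t) * h t := by
  rw [mollify, convolution_lsmul_swap]; rfl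

theorem contDiff_mollify (ρ : ContDiffBump (0 : ℝ)) {h : ℝ → ℝ} (hh : LocallyIntegrable h) :
    ContDiff ℝ ∞ (mollify ρ h) :=
  HasCompactSupport.contDiff_convolution_left _ ρ.hasCompactSupport_normed
    (ρ.contDiff_normed (μ := volume)) hh

/-- Mollification commutes with weak differentiation. -/
theorem deriv_mollify (ρ : ContDiffBump (0 : ℝ)) {h g : ℝ → ℝ}
    (hg : HasWeakDerivOn univ 1 h g) : deriv (mollify ρ h) = mollify ρ g := by
  obtain ⟨lh, -, hw⟩ := hg
  ext x
  have d := (ρ.hasCompactSupport_normed (μ := volume)).hasDerivAt_convolution_left (lsmul ℝ ℝ)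
    (ρ.contDiff_normed (n := 1)) (locallyIntegrableOn_univ.1 lh) x
  have := hw (fun t => ρ.normed volume (x - t))
    (ρ.contDiff_normed.comp (contDiff_const.sub contDiff_id))
    (ρ.hasCompactSupport_normed.comp_homeomorph (Homeomorph.subLeft x)) (subset_univ _)
  simp only [Measure.restrict_univ] at this
  rw [mollify, d.deriv, convolution_lsmul_swap, mollify_apply]
  have e : ∀ t, fderiv ℝ (fun t => ρ.normed volume (x - t)) t 1
      = - deriv (ρ.normed volume) (x - t) := by
    intro t
    rw [fderiv_apply_one_eq_deriv, deriv_comp_const_sub]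
  simp only [e, mul_neg, integral_neg, neg_inj] at this
  simp only [smul_eq_mul]
  simpa only [mul_comm] using this

/-- Jensen's inequality: the translated kernel is a probability density. -/
theorem mollify_sq_le (ρ : ContDiffBump (0 : ℝ)) {g : ℝ → ℝ} (hg : MemLp g 2) (x : ℝ) :
    mollify ρ g x ^ 2 ≤ mollify ρ (fun t => g t ^ 2) x := by
  have hc : Continuous fun t => ρ.normed volume (x - t) :=
    ρ.continuous_normed.comp (continuous_const.sub continuous_id)
  have hs : HasCompactSupport fun t => ρ.normed volume (x - t) :=
    ρ.hasCompactSupport_normed.comp_homeomorph (Homeomorph.subLeft x)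
  rw [mollify_apply, mollify_apply]
  refine sq_integral_density_le (fun t => ρ.nonneg_normed _)
    (hc.integrable_of_hasCompactSupport hs) ?_ ?_ ?_
  · rw [integral_sub_left_eq_self (ρ.normed volume) volume x, ρ.integral_normed]
  · have := (hg.locallyIntegrable (by norm_num)).integrable_smul_left_of_hasCompactSupport hc hs
    simpa using this
  · have := hg.integrable_sq.locallyIntegrable.integrable_smul_left_of_hasCompactSupport hc hs
    simpa using this

theorem integrable_mollify (ρ : ContDiffBump (0 : ℝ)) {g : ℝ → ℝ} (hg : Integrable g) :
    Integrable (mollify ρ g) :=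
  ρ.integrable_normed.integrable_convolution _ hg

theorem integral_mollify (ρ : ContDiffBump (0 : ℝ)) {g : ℝ → ℝ} (hg : Integrable g) :
    ∫ x, mollify ρ g x = ∫ x, g x := by
  rw [mollify, integral_convolution _ ρ.integrable_normed hg, ρ.integral_normed]
  simp

/-- Mollification does not increase the `L²` norm. -/
theorem memLp_mollify (ρ : ContDiffBump (0 : ℝ)) {g : ℝ → ℝ} (hg : MemLp g 2) :
    MemLp (mollify ρ g) 2 ∧ ∫ x, mollify ρ g x ^ 2 ≤ ∫ x, g x ^ 2 := by
  have hc : Continuous (mollify ρ g) :=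
    (contDiff_mollify ρ (hg.locallyIntegrable (by norm_num))).continuous
  have i2 := integrable_mollify ρ hg.integrable_sq
  have i1 : Integrable fun x => mollify ρ g x ^ 2 :=
    i2.mono' (hc.pow 2).aestronglyMeasurable (ae_of_all _ fun x => by
      rw [Real.norm_of_nonneg (sq_nonneg _)]; exact mollify_sq_le ρ hg x)
  refine ⟨(memLp_two_iff_integrable_sq hc.aestronglyMeasurable).2 i1, ?_⟩
  rw [← integral_mollify ρ hg.integrable_sq]
  exact integral_mono i1 i2 (mollify_sq_le ρ hg)

theorem sq_sub_le_of_contDiff {k : ℝ → ℝ} (hk : ContDiff ℝ ∞ k) (hk2 : MemLp (deriv k) 2)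
    (x y : ℝ) : (k x - k y) ^ 2 ≤ |x - y| * ∫ t, deriv k t ^ 2 := by
  wlog hxy : y ≤ x generalizing x y
  · rw [← neg_sub, neg_sq, abs_sub_comm]
    exact this y x (le_of_not_ge hxy)
  have hc : Continuous (deriv k) := hk.continuous_deriv (by simp)
  have e : k x - k y = ∫ t in Ioc y x, deriv k t * 1 := by
    simp only [mul_one]
    rw [← intervalIntegral.integral_of_le hxy, intervalIntegral.integral_deriv_eq_sub
      (fun t _ => (hk.differentiable (by simp)).differentiableAt) (hc.intervalIntegrable _ _)]
  rw [e]
  have := sq_integral_mul_le (hk2.restrict (Ioc y x))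
    (memLp_const (μ := volume.restrict (Ioc y x)) (p := 2) (1 : ℝ))
  refine this.trans ?_
  have h3 : ∫ t in Ioc y x, deriv k t ^ 2 ≤ ∫ t, deriv k t ^ 2 :=
    setIntegral_le_integral hk2.integrable_sq (ae_of_all _ fun t => sq_nonneg _)
  simp only [one_pow, integral_const, smul_eq_mul, mul_one, measureReal_restrict_apply_univ,
    Real.volume_real_Ioc_of_le hxy]
  rw [abs_of_nonneg (sub_nonneg.2 hxy), mul_comm]
  exact mul_le_mul_of_nonneg_left h3 (sub_nonneg.2 hxy)

/-- The bound does not depend on `ρ`, since mollifying `g` does not increase its L² norm; it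
therefore survives the limit of shrinking kernels. -/
theorem sq_mollify_sub_le (ρ : ContDiffBump (0 : ℝ)) {h g : ℝ → ℝ}
    (hg : HasWeakDerivOn univ 1 h g) (hg2 : MemLp g 2) (x y : ℝ) :
    (mollify ρ h x - mollify ρ h y) ^ 2 ≤ |x - y| * ∫ t, g t ^ 2 := by
  have hd := deriv_mollify ρ hg
  have hm := memLp_mollify ρ hg2
  rw [← hd] at hm
  exact (sq_sub_le_of_contDiff (contDiff_mollify ρ (locallyIntegrableOn_univ.1 hg.1)) hm.1
    x y).trans (mul_le_mul_of_nonneg_left hm.2 (abs_nonneg _))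

/-- Functions with a weak derivative in `L²(ℝ)` are Hölder continuous of exponent `1 / 2`. -/
theorem sq_sub_le_of_hasWeakDerivOn {h g : ℝ → ℝ} (hc : Continuous h)
    (hg : HasWeakDerivOn univ 1 h g) (hg2 : MemLp g 2) (x y : ℝ) :
    (h x - h y) ^ 2 ≤ |x - y| * ∫ t, g t ^ 2 := by
  let ρ : ℕ → ContDiffBump (0 : ℝ) := fun n =>
    ⟨1 / ((n : ℝ) + 1) / 2, 1 / ((n : ℝ) + 1), by positivity, half_lt_self (by positivity)⟩
  have hρ : Tendsto (fun n => (ρ n).rOut) atTop (𝓝 0) := tendsto_one_div_add_atTop_nhds_zero_nat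
  have ht := fun x => ContDiffBump.convolution_tendsto_right_of_continuous (μ := volume) hρ hc x
  exact le_of_tendsto' (((ht x).sub (ht y)).pow 2) fun n => sq_mollify_sub_le (ρ n) hg hg2 x y

/-- Smooth uniform approximation with control of the `L²` norm of the derivative. -/
theorem exists_smooth_approx {h g : ℝ → ℝ} (hc : Continuous h)
    (hg : HasWeakDerivOn univ 1 h g) (hg2 : MemLp g 2) {ε : ℝ} (hε : 0 < ε) :
    ∃ k : ℝ → ℝ, ContDiff ℝ ∞ k ∧ (∀ x, |k x - h x| ≤ ε) ∧ MemLp (deriv k) 2 ∧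
      ∫ x, deriv k x ^ 2 ≤ ∫ x, g x ^ 2 := by
  set D := ∫ t, g t ^ 2
  have hD : 0 ≤ D := integral_nonneg fun t => sq_nonneg _
  -- The Hölder bound at distance δ is at most ε; `D + 1` avoids dividing by zero when `D = 0`.
  obtain ⟨δ, hδ, hδD⟩ : ∃ δ > 0, δ * D ≤ ε ^ 2 :=
    ⟨ε ^ 2 / (D + 1), by positivity, by
      rw [div_mul_eq_mul_div, div_le_iff₀ (by positivity)]
      nlinarith [sq_nonneg ε]⟩
  let ρ : ContDiffBump (0 : ℝ) := ⟨δ / 2, δ, by positivity, half_lt_self hδ⟩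
  have hm := memLp_mollify ρ hg2
  rw [← deriv_mollify ρ hg] at hm
  refine ⟨mollify ρ h, contDiff_mollify ρ (locallyIntegrableOn_univ.1 hg.1), fun x => ?_, hm⟩
  refine ContDiffBump.dist_normed_convolution_le hc.aestronglyMeasurable fun y hy => ?_
  refine abs_le_of_sq_le_sq ((sq_sub_le_of_hasWeakDerivOn hc hg hg2 y x).trans ?_) hε.le
  exact (mul_le_mul_of_nonneg_right (le_of_lt hy) hD).trans hδD

/-! ### Decay and height of the profile -/

/-- A nonnegative integrable function that is Hölder continuous has bounded superlevel sets. -/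
theorem exists_abs_le_of_le {h : ℝ → ℝ} {D : ℝ} (h0 : ∀ x, 0 ≤ h x)
    (hi : Integrable h) (hD : 0 ≤ D) (hH : ∀ x y, (h x - h y) ^ 2 ≤ |x - y| * D)
    {ε : ℝ} (hε : 0 < ε) : ∃ R, ∀ x, ε ≤ h x → |x| ≤ R := by
  -- Within distance `r` the function varies by at most ε/2, so a point with `ε ≤ h x` carries mass
  -- at least r ε/2 nearby; far out this exceeds the tail of the integral.
  obtain ⟨r, hr, hrD⟩ : ∃ r > 0, r * D ≤ (ε / 2) ^ 2 :=
    ⟨(ε / 2) ^ 2 / (D + 1), by positivity, by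
      rw [div_mul_eq_mul_div, div_le_iff₀ (by positivity)]
      nlinarith [sq_nonneg (ε / 2)]⟩
  have hm : ∀ n : ℕ, MeasurableSet {t : ℝ | (n : ℝ) ≤ |t|} := fun n =>
    (isClosed_le continuous_const continuous_abs).measurableSet
  have ht := tendsto_setIntegral_of_antitone (f := h) (μ := volume) hm
    (fun m n hmn t ht => (Nat.cast_le (α := ℝ).2 hmn).trans (show (n : ℝ) ≤ |t| from ht)) ⟨0, hi.integrableOn⟩
  have he : ⋂ n : ℕ, {t : ℝ | (n : ℝ) ≤ |t|} = ∅ := by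
    refine eq_empty_iff_forall_notMem.2 fun t ht => ?_
    obtain ⟨n, hn⟩ := exists_nat_gt |t|
    exact absurd (mem_iInter.1 ht n) (not_le.2 hn)
  rw [he, setIntegral_empty] at ht
  obtain ⟨n, hn⟩ := (ht.eventually_lt_const (show 0 < r * (ε / 2) by positivity)).exists
  refine ⟨n + r, fun x hx => ?_⟩
  by_contra! hxr
  refine absurd hn (not_lt.2 ?_)
  have hsub : Icc x (x + r) ⊆ {t : ℝ | (n : ℝ) ≤ |t|} := by
    rintro t ⟨h1, h2⟩
    have : |x| ≤ |t| + |x - t| := by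
      have := abs_add_le t (x - t)
      simpa using this
    have h3 : |x - t| ≤ r := by rw [abs_le]; constructor <;> linarith
    simp only [mem_ofPred_eq]
    linarith
  have hlow : ∀ t ∈ Icc x (x + r), ε / 2 ≤ h t := by
    rintro t ⟨h1, h2⟩
    have h3 : |x - t| ≤ r := by rw [abs_le]; constructor <;> linarith
    have := abs_le_of_sq_le_sq ((hH x t).trans ((mul_le_mul_of_nonneg_right h3 hD).trans hrD))
      (by positivity)
    have := (abs_le.1 this).2
    linarith
  calc r * (ε / 2) = ∫ t in Icc x (x + r), ε / 2 := by simp [hr.le]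
    _ ≤ ∫ t in Icc x (x + r), h t := by
        refine setIntegral_mono_on ?_ hi.integrableOn measurableSet_Icc hlow
        exact integrableOn_const (by simp)
    _ ≤ _ := setIntegral_mono_set hi.integrableOn (ae_of_all _ h0) hsub.eventuallyLE

/-- If the volume and the slope are small, the film is thin. -/
theorem le_three_quarters {h : ℝ → ℝ} {D : ℝ} (h0 : ∀ x, 0 ≤ h x)
    (hi : Integrable h) (hV : ∫ x, h x ≤ 1 / 4) (hD : 0 ≤ D) (hD' : D ≤ 1 / 4)
    (hH : ∀ x y, (h x - h y) ^ 2 ≤ |x - y| * D) (x : ℝ) : h x ≤ 3 / 4 := by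
  by_contra! hx
  -- At distance at most 1 the oscillation is at most √D ≤ 1/2, so a height above 3/4 stays above
  -- 1/4 on an interval of length 2, giving mass at least 1/2.
  have hlow : ∀ t ∈ Icc (x - 1) (x + 1), 1 / 4 ≤ h t := by
    rintro t ⟨h1, h2⟩
    have h3 : |x - t| ≤ 1 := by rw [abs_le]; constructor <;> linarith
    have h4 : |x - t| * D ≤ (1 / 2) ^ 2 := by nlinarith [abs_nonneg (x - t)]
    have := (abs_le.1 (abs_le_of_sq_le_sq ((hH x t).trans h4) (by norm_num))).2
    linarith
  have : (1 : ℝ) / 2 ≤ ∫ t, h t := calc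
    (1 : ℝ) / 2 = ∫ t in Icc (x - 1) (x + 1), (1 / 4 : ℝ) := by
        rw [setIntegral_const, Real.volume_real_Icc_of_le (by linarith), smul_eq_mul]; ring
    _ ≤ ∫ t in Icc (x - 1) (x + 1), h t :=
        setIntegral_mono_on (integrableOn_const (by simp)) hi.integrableOn measurableSet_Icc hlow
    _ ≤ _ := setIntegral_le_integral hi (ae_of_all _ h0)
  linarith

/-! ### Integration on the film and weak derivatives -/

theorem isOpen_film {h : ℝ → ℝ} (hc : Continuous h) : IsOpen (film h) :=
  (isOpen_lt continuous_const continuous_snd).inter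
    (isOpen_lt continuous_snd (hc.comp continuous_fst))

theorem film_eq_regionBetween (h : ℝ → ℝ) : film h = regionBetween (fun _ => 0) h univ := by
  ext p
  simp [film, regionBetween]

theorem volume_film {h : ℝ → ℝ} (h0 : ∀ x, 0 ≤ h x) (hi : Integrable h) :
    volume (film h) = ENNReal.ofReal (∫ x, h x) := by
  rw [film_eq_regionBetween, Measure.volume_eq_prod,
    volume_regionBetween_eq_integral (integrableOn_zero) hi.integrableOn MeasurableSet.univ
      fun x _ => h0 x]
  simp

/-- Fubini's theorem on the film. -/
theorem setIntegral_film {h : ℝ → ℝ} (hc : Continuous h) {f : ℝ × ℝ → ℝ}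
    (hf : IntegrableOn f (film h)) :
    ∫ p in film h, f p = ∫ x, ∫ y in Ioo 0 (h x), f (x, y) := by
  have hm := (isOpen_film hc).measurableSet
  rw [← integral_indicator hm, Measure.volume_eq_prod, integral_prod _ (hf.integrable_indicator hm)]
  congr 1; ext x
  rw [← integral_indicator measurableSet_Ioo]
  rfl

theorem hasDerivAt_slice {φ : ℝ × ℝ → ℝ} (hφ : ContDiff ℝ ∞ φ) (x y : ℝ) :
    HasDerivAt (fun y => φ (x, y)) (fderiv ℝ φ (x, y) (0, 1)) y :=
  ((hφ.differentiable (by simp)) (x, y)).hasFDerivAt.comp_hasDerivAt y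
    ((hasDerivAt_const y x).prodMk (hasDerivAt_id y))

theorem continuous_fderiv_apply {E : Type*} [NormedAddCommGroup E] [NormedSpace ℝ E]
    {φ : E → ℝ} (hφ : ContDiff ℝ ∞ φ) (v : E) : Continuous fun p => fderiv ℝ φ p v :=
  (hφ.continuous_fderiv (by simp)).clm_apply continuous_const

/-- The function `x` has bottom trace `x`. -/
theorem integral_fst_mul_fderiv {h : ℝ → ℝ} (hc : Continuous h) (h0 : ∀ x, 0 ≤ h x)
    {φ : ℝ × ℝ → ℝ} (hφ : ContDiff ℝ ∞ φ) (hs : HasCompactSupport φ)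
    (ht : tsupport φ ⊆ {p | p.2 < h p.1}) :
    ∫ p in film h, p.1 * fderiv ℝ φ p (0, 1) = -∫ x, x * φ (x, 0) := by
  have hcd := continuous_fderiv_apply hφ (0, 1)
  have hint : Integrable fun p : ℝ × ℝ => p.1 * fderiv ℝ φ p (0, 1) :=
    (continuous_fst.mul hcd).integrable_of_hasCompactSupport (hs.fderiv_apply ℝ (0, 1)).mul_left
  rw [setIntegral_film hc hint.integrableOn, ← integral_neg]
  congr 1; ext x
  -- The support avoids the graph, so the upper boundary term vanishes. Where `h x = 0` the same
  -- fact makes `φ (x, 0)` vanish, so the trace integral sees only `{h > 0}`.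
  have hz : φ (x, h x) = 0 := image_eq_zero_of_notMem_tsupport fun hx =>
    lt_irrefl (h x) (ht hx)
  rw [integral_const_mul, ← integral_Ioc_eq_integral_Ioo, ← intervalIntegral.integral_of_le (h0 x),
    intervalIntegral.integral_eq_sub_of_hasDerivAt (fun y _ => hasDerivAt_slice hφ x y)
      ((hcd.comp (Continuous.prodMk_right x)).intervalIntegrable _ _), hz]
  ring

theorem setIntegral_eq_of_tsupport_subset {E : Type*} [TopologicalSpace E] [MeasureSpace E]
    {Ω : Set E} {φ f : E → ℝ} (hs : tsupport φ ⊆ Ω) (hf : ∀ x, x ∉ tsupport φ → f x = 0) :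
    ∫ x in Ω, f x = ∫ x, f x :=
  setIntegral_eq_integral_of_forall_compl_eq_zero fun x hx => hf x fun h => hx (hs h)

/-- Classical derivatives are weak derivatives. -/
theorem hasWeakDerivOn_of_contDiff {E : Type*} [NormedAddCommGroup E] [NormedSpace ℝ E]
    [FiniteDimensional ℝ E] [MeasureSpace E] [BorelSpace E]
    [(volume : Measure E).IsAddHaarMeasure] (Ω : Set E) (v : E) {f : E → ℝ}
    (hf : ContDiff ℝ ∞ f) : HasWeakDerivOn Ω v f fun x => fderiv ℝ f x v := by
  have hcf := continuous_fderiv_apply hf v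
  refine ⟨hf.continuous.locallyIntegrable.locallyIntegrableOn _,
    hcf.locallyIntegrable.locallyIntegrableOn _, fun φ hφ hs ht => ?_⟩
  have hcφ := continuous_fderiv_apply hφ v
  rw [setIntegral_eq_of_tsupport_subset ht fun x hx => by
      rw [image_eq_zero_of_notMem_tsupport fun h =>
        hx (tsupport_fderiv_apply_subset ℝ v h), mul_zero],
    setIntegral_eq_of_tsupport_subset ht fun x hx => by
      rw [image_eq_zero_of_notMem_tsupport hx, mul_zero]]
  exact integral_mul_fderiv_eq_neg_fderiv_mul_of_integrable
    ((hcf.mul hφ.continuous).integrable_of_hasCompactSupport hs.mul_left)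
    ((hf.continuous.mul hcφ).integrable_of_hasCompactSupport (hs.fderiv_apply ℝ v).mul_left)
    ((hf.continuous.mul hφ.continuous).integrable_of_hasCompactSupport hs.mul_left)
    (fun x _ => hf.differentiable (by simp) x) fun x _ => hφ.differentiable (by simp) x

theorem hasWeakDerivOn_weakDerivOn {E : Type*} [NormedAddCommGroup E] [NormedSpace ℝ E]
    [MeasureSpace E] {Ω : Set E} {v : E} {f g : E → ℝ} (h : HasWeakDerivOn Ω v f g) :
    HasWeakDerivOn Ω v f (weakDerivOn Ω v f) := by
  have hex : ∃ g, HasWeakDerivOn Ω v f g := ⟨g, h⟩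
  rw [weakDerivOn, dif_pos hex]
  exact hex.choose_spec

theorem weakDerivOn_ae_eq {E : Type*} [NormedAddCommGroup E] [NormedSpace ℝ E]
    [FiniteDimensional ℝ E] [MeasureSpace E] [BorelSpace E] {Ω : Set E} (hΩ : IsOpen Ω)
    {v : E} {f g : E → ℝ} (h : HasWeakDerivOn Ω v f g) :
    weakDerivOn Ω v f =ᵐ[volume.restrict Ω] g :=
  (hasWeakDerivOn_weakDerivOn h).ae_unique hΩ h

/-- Uniqueness up to null sets transfers square integrability from the given derivative to the
chosen one. -/
theorem MemH1.weakDerivOn {E : Type*} [NormedAddCommGroup E] [NormedSpace ℝ E]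
    [FiniteDimensional ℝ E] [MeasureSpace E] [BorelSpace E] {Ω : Set E} (hΩ : IsOpen Ω)
    {f : E → ℝ} (h : MemH1 Ω f) (v : E) :
    HasWeakDerivOn Ω v f (weakDerivOn Ω v f) ∧
      MemLp (ThinFilm.weakDerivOn Ω v f) 2 (volume.restrict Ω) := by
  obtain ⟨g, hg, hg2⟩ := h.2 v
  exact ⟨hasWeakDerivOn_weakDerivOn hg, hg2.ae_eq (weakDerivOn_ae_eq hΩ hg).symm⟩

/-! ### Upper bound by flat profiles -/

/-- The pairs `(x, h)` with a smooth compactly supported profile are admissible. -/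
theorem fst_admissible {h : ℝ → ℝ} (hh : ContDiff ℝ ∞ h) (hs : HasCompactSupport h)
    (h0 : ∀ x, 0 ≤ h x) :
    (Prod.fst, h) ∈ admissible (∫ x, h x) ∧
      energy (Prod.fst, h) = (∫ x, h x) + ∫ x, deriv h x ^ 2 := by
  have hi : Integrable h := hh.continuous.integrable_of_hasCompactSupport hs
  have hop := isOpen_film hh.continuous
  have hfst : ∀ v : ℝ × ℝ, HasWeakDerivOn (film h) v Prod.fst fun _ => v.1 := fun v => by
    simpa [fderiv_fst] using hasWeakDerivOn_of_contDiff (film h) v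
      (contDiff_fst (𝕜 := ℝ) (E := ℝ) (F := ℝ) (n := ∞))
  have hder : HasWeakDerivOn univ 1 h (deriv h) := by
    simpa using hasWeakDerivOn_of_contDiff univ 1 hh
  have hvol := volume_film h0 hi
  have hfin : IsFiniteMeasure (volume.restrict (film h)) :=
    ⟨by rw [Measure.restrict_apply_univ, hvol]; exact ENNReal.ofReal_lt_top⟩
  obtain ⟨R, hR⟩ := hs.isBounded.exists_norm_le
  have hbd : ∀ p ∈ film h, ‖p.1‖ ≤ R := fun p hp =>
    hR _ (subset_tsupport h (ne_of_gt (hp.1.trans hp.2)))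
  refine ⟨⟨hh.continuous, ⟨hh.continuous.memLp_of_hasCompactSupport hs |>.restrict _, fun v => ?_⟩,
    h0, ⟨?_, fun v => ⟨_, hfst v, memLp_const _⟩⟩, hi, rfl, ?_⟩, ?_⟩
  · refine ⟨_, hasWeakDerivOn_of_contDiff univ v hh, MemLp.restrict _ ?_⟩
    exact (continuous_fderiv_apply hh v).memLp_of_hasCompactSupport (hs.fderiv_apply ℝ v)
  · exact MemLp.of_bound continuous_fst.aestronglyMeasurable R
      ((ae_restrict_iff' hop.measurableSet).2 (ae_of_all _ hbd))
  · intro φ hφ hφs ht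
    rw [← integral_fst_mul_fderiv hh.continuous h0 hφ hφs ht]
    refine integral_congr_ae ?_
    filter_upwards [weakDerivOn_ae_eq hop (hfst (0, 1))] with p hp
    simp [hp]
  · rw [energy, elasticEnergy, surfaceEnergy]
    congr 1
    · calc _ = ∫ p in film h, (1 : ℝ) := by
            refine integral_congr_ae ?_
            filter_upwards [weakDerivOn_ae_eq hop (hfst (0, 1)),
              weakDerivOn_ae_eq hop (hfst (1, 0))] with p hp hq
            simp [hp, hq]
        _ = _ := by
            simp [measureReal_def, hvol, ENNReal.toReal_ofReal (integral_nonneg h0)]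
    · refine integral_congr_ae ?_
      have := weakDerivOn_ae_eq isOpen_univ hder
      rw [Measure.restrict_univ] at this
      filter_upwards [this] with x hx
      rw [hx]

/-- There are admissible pairs of energy arbitrarily close to the volume. -/
theorem exists_admissible_energy_le {V : ℝ} (hV : 0 < V) {η : ℝ} (hη : 0 < η) :
    ∃ q ∈ admissible V, energy q ≤ V + η := by
  let B : ContDiffBump (0 : ℝ) := ⟨1, 2, by norm_num, by norm_num⟩
  set ρ : ℝ → ℝ := B.normed volume with hρ
  have hρs : HasCompactSupport ρ := B.hasCompactSupport_normed
  have hρc : ContDiff ℝ ∞ ρ := B.contDiff_normed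
  set C := ∫ x, deriv ρ x ^ 2
  have hC : 0 ≤ C := integral_nonneg fun _ => sq_nonneg _
  obtain ⟨t, ht, ht1, htη⟩ : ∃ t : ℝ, 0 < t ∧ t ≤ 1 ∧ t * (V ^ 2 * C) ≤ η := by
    refine ⟨min 1 (η / (V ^ 2 * C + 1)), by positivity, min_le_left _ _, ?_⟩
    refine (mul_le_mul_of_nonneg_right (min_le_right _ _) (by positivity)).trans ?_
    rw [div_mul_eq_mul_div, div_le_iff₀ (by positivity)]
    nlinarith
  -- The scaling keeps the volume equal to V and multiplies the surface energy by t³.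
  set h : ℝ → ℝ := fun x => V * t * ρ (t * x) with hh
  have hhc : ContDiff ℝ ∞ h := contDiff_const.mul (hρc.comp (contDiff_const.mul contDiff_id))
  have hhs : HasCompactSupport h :=
    HasCompactSupport.mul_left (hρs.comp_homeomorph (Homeomorph.mulLeft₀ t ht.ne'))
  have h0 : ∀ x, 0 ≤ h x := fun x =>
    mul_nonneg (by positivity) (B.nonneg_normed _)
  have hint : ∫ x, h x = V := by
    rw [hh, integral_const_mul, Measure.integral_comp_mul_left, B.integral_normed,
      abs_of_pos (inv_pos.2 ht), smul_eq_mul]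
    field_simp
  have hder : deriv h = fun x => V * t * (t * deriv ρ (t * x)) := by
    ext x
    rw [hh, deriv_const_mul_field, deriv_comp_mul_left, smul_eq_mul]
  have hsq : ∫ x, deriv h x ^ 2 = t ^ 3 * (V ^ 2 * C) := by
    have : ∀ x, deriv h x ^ 2 = (V * t * t) ^ 2 * (fun y => deriv ρ y ^ 2) (t * x) := fun x => by
      rw [hder]; ring
    rw [funext this]
    rw [integral_const_mul, Measure.integral_comp_mul_left (fun y => deriv ρ y ^ 2), abs_of_pos (inv_pos.2 ht), smul_eq_mul]
    field_simp
    rfl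
  have key := fst_admissible hhc hhs h0
  rw [hint, hsq] at key
  refine ⟨_, key.1, key.2.le.trans ?_⟩
  have : t ^ 3 ≤ t := by
    have := pow_le_pow_of_le_one ht.le ht1 (show 1 ≤ 3 by norm_num)
    simpa using this
  have := mul_le_mul_of_nonneg_right this (show 0 ≤ V ^ 2 * C by positivity)
  linarith

/-! ### Green's formula and the test fields -/

/-- Green's formula for `u - x`, tested with a field whose components `φ` and `ψ` satisfy
`∂φ/∂x + ∂ψ/∂y = 0`. -/
theorem integral_sub_one_mul_eq {h : ℝ → ℝ} (hc : Continuous h) (h0 : ∀ x, 0 ≤ h x)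
    {u a : ℝ × ℝ → ℝ} (hu : MemLp u 2 (volume.restrict (film h)))
    (ha : HasWeakDerivOn (film h) (1, 0) u a) (ha2 : MemLp a 2 (volume.restrict (film h)))
    (hb2 : MemLp (weakDerivOn (film h) (0, 1) u) 2 (volume.restrict (film h)))
    (htr : HasBottomTrace h u fun x => x) {φ ψ : ℝ × ℝ → ℝ}
    (hφ : ContDiff ℝ ∞ φ) (hφs : HasCompactSupport φ) (hφt : tsupport φ ⊆ film h)
    (hψ : ContDiff ℝ ∞ ψ) (hψs : HasCompactSupport ψ) (hψt : tsupport ψ ⊆ {p | p.2 < h p.1})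
    (hdiv : ∀ p ∈ film h, fderiv ℝ φ p (1, 0) = -fderiv ℝ ψ p (0, 1)) :
    ∫ p in film h, (a p - 1) * φ p = -∫ p in film h, weakDerivOn (film h) (0, 1) u p * ψ p := by
  set b := weakDerivOn (film h) (0, 1) u
  have hm := (isOpen_film hc).measurableSet
  have lp : ∀ {f : ℝ × ℝ → ℝ}, Continuous f → HasCompactSupport f →
      MemLp f 2 (volume.restrict (film h)) := fun hf hs =>
    (hf.memLp_of_hasCompactSupport hs).restrict _
  have e1 := ha.2.2 φ hφ hφs hφt
  have e2 := htr ψ hψ hψs hψt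
  rw [← integral_fst_mul_fderiv hc h0 hψ hψs hψt] at e2
  have e3 := (integral_add
    (hu.integrable_mul (lp (continuous_fderiv_apply hψ (0, 1)) (hψs.fderiv_apply ℝ (0, 1))))
    (hb2.integrable_mul (lp hψ.continuous hψs))).symm.trans e2
  simp only [Pi.mul_apply] at e3
  have e4 := (hasWeakDerivOn_of_contDiff (film h) (1, 0)
    (contDiff_fst (𝕜 := ℝ) (E := ℝ) (F := ℝ) (n := ∞))).2.2 φ hφ hφs hφt
  simp only [fderiv_fst, ContinuousLinearMap.coe_fst', one_mul] at e4
  -- Zero divergence makes the terms containing `u` itself cancel between the two weak formulations,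
  -- and likewise for the function `x`.
  have swap : ∀ f : ℝ × ℝ → ℝ, ∫ p in film h, f p * fderiv ℝ φ p (1, 0)
      = -∫ p in film h, f p * fderiv ℝ ψ p (0, 1) := fun f => by
    rw [← integral_neg]
    refine setIntegral_congr_fun hm fun p hp => ?_
    simp only [hdiv p hp, mul_neg]
  rw [swap] at e1 e4
  have e5 : ∫ p in film h, (a p - 1) * φ p
      = (∫ p in film h, a p * φ p) - ∫ p in film h, φ p := by
    simp only [sub_mul, one_mul]
    exact integral_sub (ha2.integrable_mul (lp hφ.continuous hφs))
      (hφ.continuous.integrable_of_hasCompactSupport hφs).integrableOn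
  linarith

/-- A smooth cutoff near the bottom together with its primitive. -/
theorem exists_cutoff_primitive {ε : ℝ} (hε : 0 < ε) : ∃ T G : ℝ → ℝ,
    ContDiff ℝ ∞ T ∧ ContDiff ℝ ∞ G ∧ (∀ y, HasDerivAt G (T y) y) ∧
    (∀ y, 0 ≤ T y ∧ T y ≤ 1) ∧ (∀ y ≤ ε, T y = 0) ∧ (∀ y, 2 * ε ≤ y → T y = 1) ∧
    (∀ y, 0 ≤ G y) ∧ (∀ y, y - 2 * ε ≤ G y) ∧ (∀ y, 0 ≤ y → G y ≤ y) := by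
  set T : ℝ → ℝ := fun y => Real.smoothTransition (y / ε - 1) with hT
  have hTc : ContDiff ℝ ∞ T :=
    Real.smoothTransition.contDiff.comp ((contDiff_id.div_const ε).sub contDiff_const)
  have hi : ∀ x y, IntervalIntegrable T volume x y := fun x y =>
    hTc.continuous.intervalIntegrable _ _
  have h01 : ∀ y, 0 ≤ T y ∧ T y ≤ 1 := fun y =>
    ⟨Real.smoothTransition.nonneg _, Real.smoothTransition.le_one _⟩
  have hlo : ∀ y ≤ ε, T y = 0 := fun y hy =>
    Real.smoothTransition.zero_of_nonpos (by rw [sub_nonpos, div_le_one hε]; exact hy)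
  have hhi : ∀ y, 2 * ε ≤ y → T y = 1 := fun y hy =>
    Real.smoothTransition.one_of_one_le (by rw [le_sub_iff_add_le, le_div_iff₀ hε]; linarith)
  have hd : ∀ y, HasDerivAt (fun y => ∫ t in (0 : ℝ)..y, T t) (T y) y := fun y =>
    intervalIntegral.integral_hasDerivAt_right (hi _ _)
      (hTc.continuous.stronglyMeasurableAtFilter _ _) hTc.continuous.continuousAt
  have hpos : ∀ x y, x ≤ y → 0 ≤ ∫ t in x..y, T t := fun x y hxy =>
    intervalIntegral.integral_nonneg hxy fun t _ => (h01 t).1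
  have hneg : ∀ y ≤ 0, ∫ t in (0 : ℝ)..y, T t = 0 := fun y hy => by
    rw [intervalIntegral.integral_symm, neg_eq_zero]
    refine (intervalIntegral.integral_congr (g := fun _ => 0) fun t ht => ?_).trans (by simp)
    rw [uIcc_of_le hy] at ht
    exact hlo t (ht.2.trans hε.le)
  have hnn : ∀ y, 0 ≤ ∫ t in (0 : ℝ)..y, T t := fun y => by
    rcases le_total 0 y with hy | hy
    · exact hpos _ _ hy
    · exact (hneg y hy).ge
  refine ⟨T, fun y => ∫ t in (0 : ℝ)..y, T t, hTc, ?_, hd, h01, hlo, hhi, hnn, fun y => ?_,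
    fun y hy => ?_⟩
  · refine contDiff_infty_iff_deriv.2 ⟨fun y => (hd y).differentiableAt, ?_⟩
    rwa [funext fun y => (hd y).deriv]
  · rcases le_total y (2 * ε) with hy | hy
    · linarith [hnn y]
    · have e : ∫ t in (2 * ε)..y, T t = y - 2 * ε := by
        rw [intervalIntegral.integral_congr (g := fun _ => (1 : ℝ)) fun t ht => ?_]
        · simp
        · rw [uIcc_of_le hy] at ht
          exact hhi t ht.1
      have := intervalIntegral.integral_add_adjacent_intervals (hi 0 (2 * ε)) (hi (2 * ε) y)
      have := hpos 0 (2 * ε) (by positivity)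
      linarith
  · have := intervalIntegral.integral_mono_on hy (hi 0 y)
      (intervalIntegrable_const (c := (1 : ℝ))) fun t _ => (h01 t).2
    simpa using this

theorem hasDerivAt_slice_fst {φ : ℝ × ℝ → ℝ} (hφ : ContDiff ℝ ∞ φ) (x y : ℝ) :
    HasDerivAt (fun x => φ (x, y)) (fderiv ℝ φ (x, y) (1, 0)) x :=
  ((hφ.differentiable (by simp)) (x, y)).hasFDerivAt.comp_hasDerivAt x
    ((hasDerivAt_id x).prodMk (hasDerivAt_const x y))

/-- The test fields: `φ` approximates `1` and `ψ` approximates the slope of `h` on the film. -/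
theorem exists_test_field {h : ℝ → ℝ} {M : ℝ} (hc : Continuous h)
    (hM : ∀ x, h x ≤ M) (hsup : ∀ ε > 0, ∃ R, ∀ x, ε ≤ h x → |x| ≤ R) {ε : ℝ} (hε : 0 < ε)
    {k : ℝ → ℝ} (hk : ContDiff ℝ ∞ k) (hkh : ∀ x, |k x - h x| ≤ ε / 2) :
    ∃ φ ψ : ℝ × ℝ → ℝ,
      ContDiff ℝ ∞ φ ∧ HasCompactSupport φ ∧ tsupport φ ⊆ film h ∧
      ContDiff ℝ ∞ ψ ∧ HasCompactSupport ψ ∧ tsupport ψ ⊆ {p | p.2 < h p.1} ∧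
      (∀ p ∈ film h, fderiv ℝ φ p (1, 0) = -fderiv ℝ ψ p (0, 1)) ∧
      (∀ p, 0 ≤ φ p ∧ φ p ≤ 1) ∧ (∀ p, 2 * ε ≤ p.2 → p.2 + 5 * ε ≤ h p.1 → φ p = 1) ∧
      (∀ p, ψ p ^ 2 ≤ deriv k p.1 ^ 2) := by
  obtain ⟨T, G, hT, hG, hd, hT01, hTlo, hThi, hG0, hGlo, hGhi⟩ := exists_cutoff_primitive hε
  set P : ℝ → ℝ := fun t => Real.smoothTransition (t / ε) with hP
  -- The field P(A)(T, k') is divergence free, because (T, k') is the rotated gradient of A and P(A)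
  -- is constant along it. The shift 3ε absorbs the loss 2ε in `G` and the error ε/2 of `k`, leaving
  -- a margin ε/2 below the graph.
  set A : ℝ × ℝ → ℝ := fun p => k p.1 - 3 * ε - G p.2 with hA
  -- This cutoff equals 1 for y ≥ -1 and 0 for y ≤ -2: it makes ψ compactly supported without
  -- changing it on the film.
  set κ : ℝ → ℝ := fun y => Real.smoothTransition (y + 2) with hκ
  have hPc : ContDiff ℝ ∞ P := Real.smoothTransition.contDiff.comp (contDiff_id.div_const ε)
  have hAc : ContDiff ℝ ∞ A :=
    ((hk.comp contDiff_fst).sub contDiff_const).sub (hG.comp contDiff_snd)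
  have hκc : ContDiff ℝ ∞ κ :=
    Real.smoothTransition.contDiff.comp (contDiff_id.add contDiff_const)
  have hP01 : ∀ t, 0 ≤ P t ∧ P t ≤ 1 := fun t =>
    ⟨Real.smoothTransition.nonneg _, Real.smoothTransition.le_one _⟩
  have hκ01 : ∀ t, 0 ≤ κ t ∧ κ t ≤ 1 := fun t =>
    ⟨Real.smoothTransition.nonneg _, Real.smoothTransition.le_one _⟩
  have hk' : ContDiff ℝ ∞ (deriv k) := (contDiff_infty_iff_deriv.1 hk).2
  have hPA : ContDiff ℝ ∞ fun p => P (A p) := hPc.comp hAc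
  have hφ : ContDiff ℝ ∞ fun p : ℝ × ℝ => P (A p) * T p.2 := hPA.mul (hT.comp contDiff_snd)
  have hψ : ContDiff ℝ ∞ fun p : ℝ × ℝ => κ p.2 * (P (A p) * deriv k p.1) :=
    (hκc.comp contDiff_snd).mul (hPA.mul (hk'.comp contDiff_fst))
  have hAp : ∀ p, P (A p) ≠ 0 → 2 * ε ≤ h p.1 ∧ p.2 + ε / 2 ≤ h p.1 := by
    intro p hp
    have h1 : 0 < A p := by
      by_contra! hn
      exact hp (Real.smoothTransition.zero_of_nonpos (div_nonpos_of_nonpos_of_nonneg hn hε.le))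
    have h2 := (abs_le.1 (hkh p.1)).2
    have h3 := hG0 p.2
    have h4 := hGlo p.2
    simp only [hA] at h1
    constructor <;> linarith
  have hTp : ∀ y, T y ≠ 0 → ε ≤ y := fun y hy => by
    by_contra! hn
    exact hy (hTlo y hn.le)
  have hκp : ∀ y, κ y ≠ 0 → -2 ≤ y := fun y hy => by
    by_contra! hn
    exact hy (Real.smoothTransition.zero_of_nonpos (by linarith))
  obtain ⟨R, hR⟩ := hsup (2 * ε) (by positivity)
  have hK : IsCompact (Icc (-R) R ×ˢ Icc (-2) M) := isCompact_Icc.prod isCompact_Icc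
  have hmemK : ∀ p : ℝ × ℝ, P (A p) ≠ 0 → -2 ≤ p.2 → p ∈ Icc (-R) R ×ˢ Icc (-2) M :=
    fun p hp hy => ⟨abs_le.1 (hR _ (hAp p hp).1), hy, by linarith [(hAp p hp).2, hM p.1]⟩
  have hcl : IsClosed {p : ℝ × ℝ | p.2 + ε / 2 ≤ h p.1} :=
    isClosed_le (continuous_snd.add continuous_const) (hc.comp continuous_fst)
  refine ⟨_, _, hφ, ?_, ?_, hψ, ?_, ?_, ?_, ?_, ?_, ?_⟩
  · refine HasCompactSupport.intro hK fun p hp => ?_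
    by_contra hne
    exact hp (hmemK p (left_ne_zero_of_mul hne)
      (by linarith [hTp _ (right_ne_zero_of_mul hne)]))
  · refine (closure_minimal (t := {p | p.2 + ε / 2 ≤ h p.1} ∩ {p | ε ≤ p.2}) (fun p hp => ?_)
      (hcl.inter (isClosed_le continuous_const continuous_snd))).trans ?_
    · exact ⟨(hAp p (left_ne_zero_of_mul hp)).2, hTp _ (right_ne_zero_of_mul hp)⟩
    · rintro p ⟨h1, h2⟩
      have h1' : p.2 + ε / 2 ≤ h p.1 := h1
      exact ⟨hε.trans_le h2, by linarith⟩
  · refine HasCompactSupport.intro hK fun p hp => ?_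
    by_contra hne
    exact hp (hmemK p (left_ne_zero_of_mul (right_ne_zero_of_mul hne))
      (hκp _ (left_ne_zero_of_mul hne)))
  · refine (closure_minimal (t := {p | p.2 + ε / 2 ≤ h p.1}) (fun p hp => ?_) hcl).trans ?_
    · exact (hAp p (left_ne_zero_of_mul (right_ne_zero_of_mul hp))).2
    · intro p h1
      have h1' : p.2 + ε / 2 ≤ h p.1 := h1
      exact show p.2 < h p.1 by linarith
  · rintro ⟨x, y⟩ ⟨hy, -⟩
    have hPd : HasDerivAt P (deriv P (A (x, y))) (A (x, y)) :=
      (hPc.differentiable (by simp)).differentiableAt.hasDerivAt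
    have hkd : HasDerivAt k (deriv k x) x :=
      (hk.differentiable (by simp)).differentiableAt.hasDerivAt
    have d1 : HasDerivAt (fun x => P (A (x, y)) * T y) (deriv P (A (x, y)) * deriv k x * T y) x :=
      (hPd.comp x ((hkd.sub_const _).sub_const _)).mul_const _
    have d2 : HasDerivAt (fun y => P (A (x, y)) * deriv k x)
        (deriv P (A (x, y)) * -T y * deriv k x) y :=
      (hPd.comp y ((hd y).const_sub _)).mul_const _
    have d3 : HasDerivAt (fun y => κ y * (P (A (x, y)) * deriv k x))
        (deriv P (A (x, y)) * -T y * deriv k x) y := by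
      refine d2.congr_of_eventuallyEq ?_
      filter_upwards [lt_mem_nhds hy] with z hz
      have : κ z = 1 := Real.smoothTransition.one_of_one_le (by linarith)
      rw [this, one_mul]
    rw [(hasDerivAt_slice_fst hφ x y).unique d1, (hasDerivAt_slice hψ x y).unique d3]
    ring
  · exact fun p => ⟨mul_nonneg (hP01 _).1 (hT01 _).1, mul_le_one₀ (hP01 _).2 (hT01 _).1 (hT01 _).2⟩
  · intro p h1 h2
    -- The gap 5ε exceeds the total cost 3ε + ε/2 + ε of the shift, the approximation error and the
    -- transition of `P`.
    have h3 : ε ≤ A p := by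
      have := (abs_le.1 (hkh p.1)).1
      have := hGhi p.2 (by linarith)
      simp only [hA]
      linarith
    have h4 : P (A p) = 1 := Real.smoothTransition.one_of_one_le ((one_le_div hε).2 h3)
    rw [h4, hThi _ h1, one_mul]
  · intro p
    have h1 : 0 ≤ κ p.2 * P (A p) := mul_nonneg (hκ01 _).1 (hP01 _).1
    have h2 : κ p.2 * P (A p) ≤ 1 := mul_le_one₀ (hκ01 _).2 (hP01 _).1 (hP01 _).2
    rw [← mul_assoc, mul_pow]
    exact mul_le_of_le_one_left (sq_nonneg _) (pow_le_one₀ h1 h2)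

/-- The key estimate: with `M` a bound for the thickness of the film, the integral of `u_x - 1` is
controlled by the `L²` norms of `u_y` and of the slope. -/
theorem sq_integral_sub_one_le {h g : ℝ → ℝ} {M : ℝ} (hc : Continuous h) (h0 : ∀ x, 0 ≤ h x)
    (hi : Integrable h) (hM : ∀ x, h x ≤ M) (hg : HasWeakDerivOn univ 1 h g) (hg2 : MemLp g 2)
    {u a : ℝ × ℝ → ℝ} (hu : MemLp u 2 (volume.restrict (film h)))
    (ha : HasWeakDerivOn (film h) (1, 0) u a) (ha2 : MemLp a 2 (volume.restrict (film h)))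
    (hb2 : MemLp (weakDerivOn (film h) (0, 1) u) 2 (volume.restrict (film h)))
    (htr : HasBottomTrace h u fun x => x) :
    (∫ p in film h, (a p - 1)) ^ 2 ≤
      (∫ p in film h, weakDerivOn (film h) (0, 1) u p ^ 2) * (M * ∫ x, g x ^ 2) := by
  set b := weakDerivOn (film h) (0, 1) u
  set D := ∫ x, g x ^ 2
  have hM0 : 0 ≤ M := (h0 0).trans (hM 0)
  have hm := (isOpen_film hc).measurableSet
  have hfin : IsFiniteMeasure (volume.restrict (film h)) :=
    ⟨by rw [Measure.restrict_apply_univ, volume_film h0 hi]; exact ENNReal.ofReal_lt_top⟩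
  have hint : Integrable (fun p => a p - 1) (volume.restrict (film h)) :=
    (ha2.integrable (by norm_num)).sub (integrable_const _)
  have hsup : ∀ ε > 0, ∃ R, ∀ x, ε ≤ h x → |x| ≤ R := fun ε hε =>
    exists_abs_le_of_le h0 hi (integral_nonneg fun _ => sq_nonneg _)
      (sq_sub_le_of_hasWeakDerivOn hc hg hg2) hε
  have step : ∀ n : ℕ, ∃ φ : ℝ × ℝ → ℝ, Continuous φ ∧ (∀ p, 0 ≤ φ p ∧ φ p ≤ 1) ∧
      (∀ p, 2 * (1 / ((n : ℝ) + 1)) ≤ p.2 → p.2 + 5 * (1 / ((n : ℝ) + 1)) ≤ h p.1 → φ p = 1) ∧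
      (∫ p in film h, (a p - 1) * φ p) ^ 2 ≤ (∫ p in film h, b p ^ 2) * (M * D) := by
    intro n
    have hε : 0 < 1 / ((n : ℝ) + 1) := by positivity
    obtain ⟨k, hk, hkh, hk2, hkD⟩ := exists_smooth_approx hc hg hg2 (half_pos hε)
    obtain ⟨φ, ψ, hφ, hφs, hφt, hψ, hψs, hψt, hdiv, hφ01, hφ1, hψk⟩ :=
      exists_test_field hc hM hsup hε hk hkh
    refine ⟨φ, hφ.continuous, hφ01, hφ1, ?_⟩
    rw [integral_sub_one_mul_eq hc h0 hu ha ha2 hb2 htr hφ hφs hφt hψ hψs hψt hdiv, neg_sq]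
    refine (sq_integral_mul_le hb2 ((hψ.continuous.memLp_of_hasCompactSupport hψs).restrict
      _)).trans (mul_le_mul_of_nonneg_left ?_ (integral_nonneg fun _ => sq_nonneg _))
    have hψi : Integrable fun p => ψ p ^ 2 :=
      (hψ.continuous.memLp_of_hasCompactSupport hψs).integrable_sq
    rw [setIntegral_film hc hψi.integrableOn]
    -- Each vertical slice has length at most M and ψ² is bounded there by k'(x)².
    calc ∫ x, ∫ y in Ioo 0 (h x), ψ (x, y) ^ 2 ≤ ∫ x, M * deriv k x ^ 2 := by
          refine integral_mono_of_nonneg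
            (ae_of_all _ fun x => integral_nonneg fun y => sq_nonneg _)
            (hk2.integrable_sq.const_mul M) (ae_of_all _ fun x => ?_)
          have := norm_setIntegral_le_of_norm_le_const (μ := volume) (s := Ioo 0 (h x))
            (f := fun y => ψ (x, y) ^ 2) (C := deriv k x ^ 2) (by simp) fun y _ => by
              rw [Real.norm_of_nonneg (sq_nonneg _)]; exact hψk (x, y)
          rw [Real.volume_real_Ioo_of_le (h0 x), sub_zero, mul_comm] at this
          exact (le_abs_self _).trans (this.trans
            (mul_le_mul_of_nonneg_right (hM x) (sq_nonneg _)))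
      _ = M * ∫ x, deriv k x ^ 2 := integral_const_mul _ _
      _ ≤ M * D := mul_le_mul_of_nonneg_left hkD hM0
  choose φ hφc hφ01 hφ1 hφle using step
  have hlim : Tendsto (fun n => ∫ p in film h, (a p - 1) * φ n p) atTop
      (𝓝 (∫ p in film h, (a p - 1))) := by
    -- Each point of the film has positive distance to the bottom and to the graph in the vertical
    -- direction, so `φ n` is eventually 1 there.
    refine tendsto_integral_of_dominated_convergence (fun p => ‖a p - 1‖)
      (fun n => hint.aestronglyMeasurable.mul (hφc n).aestronglyMeasurable) hint.norm
      (fun n => ae_of_all _ fun p => ?_) ((ae_restrict_iff' hm).2 (ae_of_all _ fun p hp => ?_))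
    · rw [norm_mul, Real.norm_of_nonneg (hφ01 n p).1]
      exact mul_le_of_le_one_right (norm_nonneg _) (hφ01 n p).2
    · have hε := tendsto_one_div_add_atTop_nhds_zero_nat (𝕜 := ℝ)
      have e1 := (hε.const_mul 2).eventually_lt_const (show 2 * 0 < p.2 by simpa using hp.1)
      have e2 := (hε.const_mul 5).eventually_lt_const
        (show 5 * 0 < h p.1 - p.2 by simpa using hp.2)
      refine tendsto_const_nhds.congr' ?_
      filter_upwards [e1, e2] with n h1 h2
      rw [hφ1 n p h1.le (by linarith), mul_one]
  exact le_of_tendsto' (hlim.pow 2) hφle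

/-! ### Strict lower bound and conclusion -/

/-- Admissible pairs of small volume have energy larger than their volume. -/
theorem lt_energy {V : ℝ} (hV : 0 < V) (hV' : V ≤ 1 / 4) {q : (ℝ × ℝ → ℝ) × (ℝ → ℝ)}
    (hq : q ∈ admissible V) : V < energy q := by
  obtain ⟨u, h⟩ := q
  obtain ⟨hc, hH1, h0, huH1, hi, hint, htr⟩ := hq
  dsimp only at hc hH1 h0 huH1 hi hint htr
  obtain ⟨hg, hg2⟩ := hH1.weakDerivOn isOpen_univ 1
  rw [Measure.restrict_univ] at hg2
  obtain ⟨ha, ha2⟩ := huH1.weakDerivOn (isOpen_film hc) (1, 0)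
  obtain ⟨-, hb2⟩ := huH1.weakDerivOn (isOpen_film hc) (0, 1)
  rw [energy, elasticEnergy, surfaceEnergy]
  dsimp only
  set a := weakDerivOn (film h) (1, 0) u
  set b := weakDerivOn (film h) (0, 1) u
  set g := weakDerivOn univ 1 h
  set D := ∫ x, g x ^ 2
  have hD : 0 ≤ D := integral_nonneg fun _ => sq_nonneg _
  have hH := sq_sub_le_of_hasWeakDerivOn hc hg hg2
  have hab : 0 ≤ ∫ p in film h, (a p ^ 2 + b p ^ 2) :=
    integral_nonneg fun _ => add_nonneg (sq_nonneg _) (sq_nonneg _)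
  by_contra! hle
  have hM := le_three_quarters h0 hi (hint.trans_le hV') hD (by linarith) hH
  -- With `D = 0` the Hölder bound makes h constant; the Bochner integral of a constant over the
  -- line is 0 here, contrary to V > 0.
  have hDpos : 0 < D := by
    refine hD.lt_of_ne fun hD0 => ?_
    have hconst : h = fun _ => h 0 := by
      ext x
      have := hH x 0
      rw [show ∫ x, g x ^ 2 = 0 from hD0.symm, mul_zero] at this
      exact sub_eq_zero.1 (pow_eq_zero_iff (two_ne_zero)|>.1 (le_antisymm this (sq_nonneg _)))
    rw [hconst] at hint
    simp only [integral_const, measureReal_def, Real.volume_univ, ENNReal.toReal_top,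
      zero_smul] at hint
    exact hV.ne hint
  have key := sq_integral_sub_one_le hc h0 hi hM hg hg2 huH1.1 ha ha2 hb2 htr
  have hvol := volume_film h0 hi
  have hfin : IsFiniteMeasure (volume.restrict (film h)) :=
    ⟨by rw [Measure.restrict_apply_univ, hvol]; exact ENNReal.ofReal_lt_top⟩
  have ia : Integrable (fun p => a p - 1) (volume.restrict (film h)) :=
    (ha2.integrable (by norm_num)).sub (integrable_const _)
  have ia2 : Integrable (fun p => (a p - 1) ^ 2) (volume.restrict (film h)) :=
    (ha2.sub (memLp_const 1)).integrable_sq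
  have hA : 0 ≤ ∫ p in film h, (a p - 1) ^ 2 := integral_nonneg fun _ => sq_nonneg _
  have e : ∫ p in film h, (a p ^ 2 + b p ^ 2) = (∫ p in film h, (a p - 1) ^ 2) +
      2 * (∫ p in film h, (a p - 1)) + V + ∫ p in film h, b p ^ 2 := by
    have h1 : ∫ p in film h, (1 : ℝ) = V := by
      simp [measureReal_def, hvol, hint, hV.le]
    calc _ = ∫ p in film h, ((a p - 1) ^ 2 - -2 * (a p - 1) + (1 + b p ^ 2)) := by
          congr 1; ext p; ring
      _ = _ := by
          have ib : Integrable (fun p => 1 + b p ^ 2) (volume.restrict (film h)) :=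
            (integrable_const _).add hb2.integrable_sq
          rw [integral_sub_add ia2 (ia.const_mul (-2)) ib, integral_add (integrable_const _) hb2.integrable_sq, h1, integral_const_mul]
          ring
  rw [e] at hle
  have hB : 0 ≤ ∫ p in film h, b p ^ 2 := integral_nonneg fun _ => sq_nonneg _
  set I := ∫ p in film h, (a p - 1)
  set B := ∫ p in film h, b p ^ 2
  have h2 : B + D ≤ -(2 * I) := by linarith
  have h3 : (B + D) ^ 2 ≤ (-(2 * I)) ^ 2 := pow_le_pow_left₀ (by linarith) h2 2
  -- With M = 3/4, (B + D)² ≤ 4I² ≤ 3BD, that is (B - D/2)² + 3D²/4 ≤ 0, impossible for D > 0.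
  nlinarith [sq_nonneg (B - D), mul_pos hDpos hDpos, sq_nonneg (B - D / 2)]

theorem minEnergy_eq {V : ℝ} (hV : 0 < V) (hV' : V ≤ 1 / 4) : minEnergy V = V := by
  -- Some admissible pair is needed, as the real `sInf` of an empty set is 0.
  obtain ⟨q₀, hq₀, -⟩ := exists_admissible_energy_le hV one_pos
  have hlb : ∀ e ∈ energy '' admissible V, V ≤ e := by
    rintro _ ⟨q, hq, rfl⟩
    exact (lt_energy hV hV' hq).le
  refine le_antisymm (le_of_forall_pos_le_add fun η hη => ?_)
    (le_csInf ⟨_, mem_image_of_mem _ hq₀⟩ hlb)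
  obtain ⟨q, hq, hqe⟩ := exists_admissible_energy_le hV hη
  exact (csInf_le ⟨V, hlb⟩ (mem_image_of_mem _ hq)).trans hqe

/-- The energy of `q` exceeds V by a positive gap, and some admissible pair exceeds V by at most
half of it. -/
theorem not_isMinimizer {V : ℝ} (hV : 0 < V) (hV' : V ≤ 1 / 4)
    (q : (ℝ × ℝ → ℝ) × (ℝ → ℝ)) : ¬ IsMinimizer V q := by
  rintro ⟨hq, hmin⟩
  have h := lt_energy hV hV' hq
  obtain ⟨r, hr, hre⟩ := exists_admissible_energy_le hV (half_pos (sub_pos.2 h))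
  have : energy q ≤ energy r := hmin hr
  linarith

end ThinFilm

theorem mainTheorem2 :
    ∃ Vbar : ℝ, 0 < Vbar ∧
      (∀ V : ℝ, 0 < V → V ≤ Vbar → ThinFilm.minEnergy V = V) ∧
      (∀ V : ℝ, 0 < V → V < Vbar → ¬ ∃ q, ThinFilm.IsMinimizer V q) :=
  ⟨1 / 4, by norm_num, fun _ hV hV' => ThinFilm.minEnergy_eq hV hV',
    fun _ hV hV' ⟨q, hq⟩ => ThinFilm.not_isMinimizer hV hV'.le q hq⟩
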